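/- Let $0<q<1$. For $|p|<1$ and $x\in\mathbb{C}\setminus\{0\}$ put $$\theta_p(x)=(x;p)_\infty\,(p x^{-1};p)_\infty,\qquad (a;p)_\infty=\prod_{k=0}^\infty(1-ap^k).$$ For a sequence $\psi=(\psi_n)_{n\in\mathbb{Z}}$ of complex numbers let $(\mathcal{A}\psi)_n=q^{-n+1}\psi_{n-1}+q^{-n}\psi_{n+1}$, $n\in\mathbb{Z}$, and let $D=\{\psi\in\ell^2(\mathbb{Z})\mid \mathcal{A}\psi\in\ell^2(\mathbb{Z})\}$. For $t\in\mathbb{R}\cup\{\infty\}$ let $A_t$ be the operator on $\ell^2(\mathbb{Z})$ acting as $A_t\psi=\mathcal{A}\psi$ on the domain $$\operatorname{Dom}A_t=\Big\{\psi\in D\;\Big|\;\lim_{n\to\infty}q^{-n}(\psi_{2n+1}+t\psi_{2n})=0\ \text{ and }\ \lim_{n\to\infty}q^{-n}(q\psi_{2n-1}-t\psi_{2n})=0\Big\}$$ if $t\in\mathbb{R}$, and $$\operatorname{Dom}A_\infty=\Big\{\psi\in D\;\Big|\;\lim_{n\to\infty}q^{-n}\psi_{2n}=0\Big\}$$ if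 $t=\infty$. Then: (i) for every $t\in\mathbb{R}$, the set of eigenvalues of $A_t$ in $\mathbb{C}$ is exactly the set of roots $x\in\mathbb{C}\setminus\{0\}$ of $$x\,\theta_{q^4}(q^2x^2)+t\,\theta_{q^4}(x^2)=0;$$ (ii) the set of eigenvalues of $A_\infty$ in $\mathbb{C}$ is exactly the set of roots $x\in\mathbb{C}\setminus\{0\}$ of $\theta_{q^4}(x^2)=0$; (iii) for every $t\in\mathbb{R}\cup\{\infty\}$, all eigenvalues of $A_t$ are real and simple, i.e. each eigenspace is one-dimensional. -/

import Mathlib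

open Filter Topology
open scoped lp

noncomputable section

/-- The infinite `q`-Pochhammer symbol `(a; q)_∞ = ∏_{k ≥ 0} (1 - a q^k)`. -/
def qPochInf (a q : ℂ) : ℂ := ∏' k : ℕ, (1 - a * q ^ k)

/-- The theta function `θ_q(x) = (x; q)_∞ (q x⁻¹; q)_∞`, meaningful for `x ≠ 0`. -/
def qTheta (q x : ℂ) : ℂ := qPochInf x q * qPochInf (q * x⁻¹) q

/-- The difference expression `(Aψ)_n = q^{-n+1} ψ_{n-1} + q^{-n} ψ_{n+1}` on arbitrary
doubly infinite sequences. -/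
def jacobiExpr (q : ℝ) : (ℤ → ℂ) →ₗ[ℂ] (ℤ → ℂ) where
  toFun ψ n := (q : ℂ) ^ (-n + 1) * ψ (n - 1) + (q : ℂ) ^ (-n) * ψ (n + 1)
  map_add' ψ χ := by
    funext n
    simp only [Pi.add_apply]
    ring
  map_smul' c ψ := by
    funext n
    simp only [Pi.smul_apply, smul_eq_mul, RingHom.id_apply]
    ring

/-- The maximal operator of the difference expression, with domain
`D = {ψ ∈ ℓ²(ℤ) | Aψ ∈ ℓ²(ℤ)}`. -/
def jacobiMax (q : ℝ) : ℓ²(ℤ, ℂ) →ₗ.[ℂ] ℓ²(ℤ, ℂ) where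
  domain :=
    { carrier := {ψ | Memℓp (jacobiExpr q ψ) 2}
      add_mem' := by
        intro ψ χ hψ hχ
        have h := Memℓp.add hψ hχ
        rw [← map_add] at h
        exact h
      zero_mem' := by
        have h : jacobiExpr q ((0 : ℓ²(ℤ, ℂ)) : ℤ → ℂ) = 0 := map_zero (jacobiExpr q)
        change Memℓp (jacobiExpr q ((0 : ℓ²(ℤ, ℂ)) : ℤ → ℂ)) 2
        rw [h]
        exact zero_memℓp
      smul_mem' := by
        intro c ψ hψ
        have h := Memℓp.const_smul hψ c
        rw [← map_smul] at h
        exact h }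
  toFun :=
    { toFun := fun ψ => ⟨jacobiExpr q (ψ : ℓ²(ℤ, ℂ)), ψ.2⟩
      map_add' := fun ψ χ => Subtype.ext (map_add (jacobiExpr q) (ψ.1 : ℤ → ℂ) (χ.1 : ℤ → ℂ))
      map_smul' := fun c ψ => Subtype.ext (map_smul (jacobiExpr q) c (ψ.1 : ℤ → ℂ)) }

/-- The boundary condition at `+∞` labelled by `t ∈ ℝ ∪ {∞}`. -/
def boundaryCond (q : ℝ) : OnePoint ℝ → (ℤ → ℂ) → Prop
  | OnePoint.infty, ψ =>
      Tendsto (fun n : ℕ => (q : ℂ) ^ (-(n : ℤ)) * ψ (2 * n)) atTop (𝓝 0)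
  | OnePoint.some t, ψ =>
      Tendsto (fun n : ℕ => (q : ℂ) ^ (-(n : ℤ)) * (ψ (2 * n + 1) + (t : ℂ) * ψ (2 * n)))
        atTop (𝓝 0) ∧
      Tendsto (fun n : ℕ =>
          (q : ℂ) ^ (-(n : ℤ)) * ((q : ℂ) * ψ (2 * n - 1) - (t : ℂ) * ψ (2 * n)))
        atTop (𝓝 0)

/-- The sequences in `ℓ²(ℤ)` satisfying the boundary condition labelled by `t`. -/
def boundarySpace (q : ℝ) (t : OnePoint ℝ) : Submodule ℂ ℓ²(ℤ, ℂ) where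
  carrier := {ψ | boundaryCond q t ψ}
  add_mem' := by
    intro ψ χ hψ hχ
    cases t using OnePoint.rec with
    | infty =>
      have h := Tendsto.add hψ hχ
      rw [add_zero] at h
      refine h.congr fun n => ?_
      simp only [lp.coeFn_add, Pi.add_apply]
      ring
    | coe t =>
      refine ⟨(add_zero (0 : ℂ)) ▸ (Tendsto.add hψ.1 hχ.1).congr fun n => ?_,
        (add_zero (0 : ℂ)) ▸ (Tendsto.add hψ.2 hχ.2).congr fun n => ?_⟩ <;>
      · simp only [lp.coeFn_add, Pi.add_apply]
        ring
  zero_mem' := by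
    cases t using OnePoint.rec with
    | infty =>
      refine tendsto_const_nhds.congr fun n => ?_
      simp
    | coe t =>
      refine ⟨tendsto_const_nhds.congr fun n => ?_, tendsto_const_nhds.congr fun n => ?_⟩ <;>
      simp
  smul_mem' := by
    intro c ψ hψ
    cases t using OnePoint.rec with
    | infty =>
      have h := Tendsto.const_mul c hψ
      rw [mul_zero] at h
      refine h.congr fun n => ?_
      simp only [lp.coeFn_smul, Pi.smul_apply, smul_eq_mul]
      ring
    | coe t =>
      refine ⟨(mul_zero c) ▸ (Tendsto.const_mul c hψ.1).congr fun n => ?_,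
        (mul_zero c) ▸ (Tendsto.const_mul c hψ.2).congr fun n => ?_⟩ <;>
      · simp only [lp.coeFn_smul, Pi.smul_apply, smul_eq_mul]
        ring

/-- The operator `A_t`, `t ∈ ℝ ∪ {∞}`: the restriction of the maximal operator to those
`ψ ∈ D` that satisfy the boundary condition labelled by `t`. -/
def jacobiExt (q : ℝ) (t : OnePoint ℝ) : ℓ²(ℤ, ℂ) →ₗ.[ℂ] ℓ²(ℤ, ℂ) :=
  (jacobiMax q).domRestrict (boundarySpace q t)

/-- The eigenspace `{ψ ∈ Dom T | T ψ = x ψ}` of an unbounded operator `T`. -/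
def pmapEigenspace {E : Type*} [AddCommGroup E] [Module ℂ E] (T : E →ₗ.[ℂ] E) (x : ℂ) :
    Submodule ℂ T.domain :=
  LinearMap.ker (T.toFun - x • T.domain.subtype)

/-- The point spectrum (set of eigenvalues) of an unbounded operator. -/
def pointSpectrum {E : Type*} [AddCommGroup E] [Module ℂ E] (T : E →ₗ.[ℂ] E) : Set ℂ :=
  {x | pmapEigenspace T x ≠ ⊥}

end

/-! The equation `𝒜ψ = xψ` is the recurrence `ψ_{n+1} = x q^n ψ_n - q ψ_{n-1}`. For `x ≠ 0` it has
the explicit solution `eigenSeq`, built from a q-Airy series whose argument tends to `0` as `n →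
-∞`, so that the Gaussian prefactor makes it decay there. At `+∞`, the shift `k = n + j` of the
summation index turns its values at `2n` and `2n+1` into `(-1)^n q^n` times sums over all `j : ℤ`
that converge to full theta series. The Jacobi triple product identifies the limits as a common
nonzero constant times `θ(x²)` and `x θ(q²x²)`, with base `q⁴`. Hence `eigenSeq` lies in `ℓ²`, and
its boundary condition is exactly the theta equation. The Wronskian of two solutions for the same
`x` is proportional to `q^n`, which is unbounded at `-∞`; for `ℓ²` solutions it therefore vanishes.
So every eigenvector is a multiple of `eigenSeq`, which gives the spectrum and simplicity
(`mem_pointSpectrum_jacobiExt_iff`, `exists_eq_smul_of_recurrence`). For `x = 0` the recurrence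
`ψ_{n+2} = -q ψ_n` has no nonzero bounded solution. Reality follows from Green's formula, because
the boundary condition kills the Wronskian of `ψ` with its conjugate at `+∞`. -/

/-! ### q-factorials and theta series -/

/-- The reciprocal `1 / (p; p)_m` of the finite `q`-factorial, extended by zero to negative `m`. -/
noncomputable def qFactorialInv (p : ℂ) (m : ℤ) : ℂ :=
  if m < 0 then 0 else (∏ k ∈ Finset.range m.toNat, (1 - p * p ^ k))⁻¹

/-- The terms `(-1)^j s^{j(j-1)} y^j` of the theta series. -/
noncomputable def thetaTerm (s y : ℂ) (j : ℤ) : ℂ := (-1) ^ j * s ^ (j * (j - 1)) * y ^ j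

lemma one_sub_mul_pow_ne_zero {p : ℂ} (hp : ‖p‖ < 1) (k : ℕ) : 1 - p * p ^ k ≠ 0 := by
  intro h
  have h1 : p ^ (k + 1) = 1 := by rw [pow_succ']; exact (sub_eq_zero.mp h).symm
  have h2 : ‖p‖ ^ (k + 1) < 1 := pow_lt_one₀ (norm_nonneg _) hp (by omega)
  rw [← norm_pow, h1, norm_one] at h2
  exact lt_irrefl _ h2

lemma qFactorialInv_natCast (p : ℂ) (n : ℕ) :
    qFactorialInv p n = (∏ k ∈ Finset.range n, (1 - p * p ^ k))⁻¹ := by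
  simp [qFactorialInv]

lemma qFactorialInv_of_neg (p : ℂ) {m : ℤ} (hm : m < 0) : qFactorialInv p m = 0 := by
  simp [qFactorialInv, hm]

lemma qFactorialInv_zero (p : ℂ) : qFactorialInv p 0 = 1 := by
  simp [qFactorialInv]

/-- At `m = 0` both sides vanish thanks to the extension by zero. Sums over `ℤ` can thus be
reindexed without boundary terms. -/
lemma one_sub_zpow_mul_qFactorialInv {p : ℂ} (hp : ‖p‖ < 1) (m : ℤ) :
    (1 - p ^ m) * qFactorialInv p m = qFactorialInv p (m - 1) := by
  rcases lt_trichotomy m 0 with h | h | h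
  · rw [qFactorialInv_of_neg p h, qFactorialInv_of_neg p (by omega), mul_zero]
  · subst h
    rw [qFactorialInv_of_neg p (by omega : (0 : ℤ) - 1 < 0)]
    simp
  · obtain ⟨n, rfl⟩ : ∃ n : ℕ, m = ((n + 1 : ℕ) : ℤ) := ⟨(m - 1).toNat, by omega⟩
    have h1 : (((n + 1 : ℕ) : ℤ) - 1) = (n : ℤ) := by push_cast; ring
    rw [h1, qFactorialInv_natCast, qFactorialInv_natCast, Finset.prod_range_succ, zpow_natCast,
      mul_inv, pow_succ']
    have := one_sub_mul_pow_ne_zero hp n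
    field_simp

lemma summable_norm_mul_pow {p : ℂ} (hp : ‖p‖ < 1) (a : ℂ) :
    Summable fun k : ℕ => ‖-(a * p ^ k)‖ := by
  simp only [norm_neg, norm_mul, norm_pow]
  exact (summable_geometric_of_lt_one (norm_nonneg _) hp).mul_left _

lemma tendsto_prod_qPochInf {p : ℂ} (hp : ‖p‖ < 1) (a : ℂ) :
    Tendsto (fun n : ℕ => ∏ k ∈ Finset.range n, (1 - a * p ^ k)) atTop (𝓝 (qPochInf a p)) := by
  have h := (multipliable_one_add_of_summable (summable_norm_mul_pow hp a)).hasProd.tendsto_prod_nat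
  simpa [← sub_eq_add_neg, qPochInf] using h

lemma qPochInf_self_ne_zero {p : ℂ} (hp : ‖p‖ < 1) : qPochInf p p ≠ 0 := by
  have h := tprod_one_add_ne_zero_of_summable (f := fun k : ℕ => -(p * p ^ k))
    (fun k => by simpa [← sub_eq_add_neg] using one_sub_mul_pow_ne_zero hp k)
    (summable_norm_mul_pow hp p)
  simpa [← sub_eq_add_neg, qPochInf] using h

lemma tendsto_qFactorialInv_natCast {p : ℂ} (hp : ‖p‖ < 1) :
    Tendsto (fun n : ℕ => qFactorialInv p n) atTop (𝓝 (qPochInf p p)⁻¹) := by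
  simp only [qFactorialInv_natCast]
  exact (tendsto_prod_qPochInf hp p).inv₀ (qPochInf_self_ne_zero hp)

lemma tendsto_qFactorialInv {p : ℂ} (hp : ‖p‖ < 1) :
    Tendsto (qFactorialInv p) atTop (𝓝 (qPochInf p p)⁻¹) := by
  have h : Tendsto Int.toNat atTop atTop :=
    tendsto_atTop.2 fun b => by
      filter_upwards [eventually_ge_atTop (b : ℤ)] with m hm
      omega
  refine ((tendsto_qFactorialInv_natCast hp).comp h).congr' ?_
  filter_upwards [eventually_ge_atTop 0] with m hm
  simp [hm]

lemma exists_norm_qFactorialInv_le {p : ℂ} (hp : ‖p‖ < 1) :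
    ∃ C : ℝ, 0 ≤ C ∧ ∀ m, ‖qFactorialInv p m‖ ≤ C := by
  obtain ⟨C, hC⟩ := (tendsto_qFactorialInv_natCast hp).norm.bddAbove_range
  have hC' : ∀ n : ℕ, ‖qFactorialInv p n‖ ≤ C := fun n => hC ⟨n, rfl⟩
  have h0 : 0 ≤ C := (norm_nonneg _).trans (hC' 0)
  refine ⟨C, h0, fun m => ?_⟩
  rcases lt_or_ge m 0 with h | h
  · simpa [qFactorialInv_of_neg p h] using h0
  · obtain ⟨n, rfl⟩ := Int.eq_ofNat_of_zero_le h
    exact hC' n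

lemma thetaTerm_succ {s y : ℂ} (hs : s ≠ 0) (hy : y ≠ 0) (j : ℤ) :
    thetaTerm s y (j + 1) = -(s ^ (2 * j) * y) * thetaTerm s y j := by
  have h : (j + 1) * (j + 1 - 1) = j * (j - 1) + 2 * j := by ring
  rw [thetaTerm, thetaTerm, h, zpow_add₀ hs, zpow_add_one₀ hy, zpow_add_one₀ (by norm_num)]
  ring

lemma thetaTerm_ne_zero {s y : ℂ} (hs : s ≠ 0) (hy : y ≠ 0) (j : ℤ) : thetaTerm s y j ≠ 0 :=
  mul_ne_zero (mul_ne_zero (zpow_ne_zero _ (by norm_num)) (zpow_ne_zero _ hs)) (zpow_ne_zero _ hy)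

lemma thetaTerm_neg {s y : ℂ} (hs : s ≠ 0) (j : ℤ) :
    thetaTerm s y (-j) = thetaTerm s (s ^ 2 * y⁻¹) j := by
  have h : -j * (-j - 1) = j * (j - 1) + 2 * j := by ring
  have h1 : (-1 : ℂ) ^ (-j) = (-1) ^ j := by rw [zpow_neg, ← inv_zpow]; norm_num
  rw [thetaTerm, thetaTerm, h, zpow_add₀ hs, h1, mul_zpow, inv_zpow, zpow_neg,
    zpow_mul s 2 j]
  simp only [zpow_ofNat]
  ring

lemma thetaTerm_mul (s a y : ℂ) (j : ℤ) : thetaTerm s (a * y) j = a ^ j * thetaTerm s y j := by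
  rw [thetaTerm, thetaTerm, mul_zpow]; ring

lemma summable_norm_thetaTerm_natCast {s y : ℂ} (hs : s ≠ 0) (hs1 : ‖s‖ < 1) (hy : y ≠ 0) :
    Summable fun n : ℕ => ‖thetaTerm s y n‖ := by
  refine summable_of_ratio_test_tendsto_lt_one (l := 0) one_pos
    (Eventually.of_forall fun n => norm_ne_zero_iff.2 (thetaTerm_ne_zero hs hy _)) ?_
  have h : Tendsto (fun n : ℕ => (‖s‖ ^ 2) ^ n * ‖y‖) atTop (𝓝 (0 * ‖y‖)) :=
    (tendsto_pow_atTop_nhds_zero_of_lt_one (by positivity)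
      (pow_lt_one₀ (norm_nonneg _) hs1 two_ne_zero)).mul_const _
  rw [zero_mul] at h
  refine h.congr fun n => ?_
  have h0 := norm_ne_zero_iff.2 (thetaTerm_ne_zero hs hy n)
  push_cast
  rw [thetaTerm_succ hs hy]
  simp only [norm_norm, norm_mul, norm_neg]
  rw [mul_div_cancel_right₀ _ h0, norm_zpow, zpow_mul]
  norm_cast

lemma summable_norm_thetaTerm {s y : ℂ} (hs : s ≠ 0) (hs1 : ‖s‖ < 1) (hy : y ≠ 0) :
    Summable fun j : ℤ => ‖thetaTerm s y j‖ := by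
  refine Summable.of_nat_of_neg (summable_norm_thetaTerm_natCast hs hs1 hy) ?_
  simp only [thetaTerm_neg hs]
  exact summable_norm_thetaTerm_natCast hs hs1 (by positivity)

lemma tsum_thetaTerm_inv {s y : ℂ} (hs : s ≠ 0) :
    ∑' j, thetaTerm s (s ^ 2 * y⁻¹) j = ∑' j, thetaTerm s y j := by
  simp only [← thetaTerm_neg hs]
  exact (Equiv.neg ℤ).tsum_eq (thetaTerm s y)

lemma HasSum.comp_int_add {f : ℤ → ℂ} {a : ℂ} (h : HasSum f a) (c : ℤ) :
    HasSum (fun j => f (j + c)) a :=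
  (Equiv.addRight c).hasSum_iff.2 h

/-! ### Jacobi triple product -/

/-- The finite form of the Jacobi triple product identity. -/
lemma hasSum_finite_tripleProduct {s y : ℂ} (hs : s ≠ 0) (hs1 : ‖s‖ < 1) (hy : y ≠ 0) (N : ℕ) :
    HasSum (fun j : ℤ => qFactorialInv (s ^ 2) (N + j) * qFactorialInv (s ^ 2) (N - j) *
        thetaTerm s y j)
      ((∏ k ∈ Finset.range N, (1 - y * (s ^ 2) ^ k)) *
        (∏ k ∈ Finset.range N, (1 - s ^ 2 * y⁻¹ * (s ^ 2) ^ k)) *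
        qFactorialInv (s ^ 2) ((2 * N : ℕ) : ℤ)) := by
  have hp1 : ‖s ^ 2‖ < 1 := by
    rw [norm_pow]; exact pow_lt_one₀ (norm_nonneg _) hs1 two_ne_zero
  have hp : s ^ 2 ≠ 0 := pow_ne_zero _ hs
  have step := one_sub_zpow_mul_qFactorialInv hp1
  induction N with
  | zero =>
    have h : ∀ j : ℤ, j ≠ 0 → qFactorialInv (s ^ 2) ((0 : ℕ) + j) *
        qFactorialInv (s ^ 2) ((0 : ℕ) - j) * thetaTerm s y j = 0 := by
      intro j hj
      rcases lt_or_gt_of_ne hj with h | h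
      · rw [qFactorialInv_of_neg _ (by push_cast; omega : ((0 : ℕ) : ℤ) + j < 0)]; simp
      · rw [qFactorialInv_of_neg _ (by push_cast; omega : ((0 : ℕ) : ℤ) - j < 0)]; simp
    simpa [qFactorialInv_zero, thetaTerm] using hasSum_single 0 h
  | succ N ih =>
    set p := s ^ 2 with hpdef
    set P := (∏ k ∈ Finset.range N, (1 - y * p ^ k)) *
        (∏ k ∈ Finset.range N, (1 - p * y⁻¹ * p ^ k)) * qFactorialInv p ((2 * N : ℕ) : ℤ) with hP
    have hpow1 : p ^ (2 * N + 1) = (p ^ N) ^ 2 * p := by rw [pow_succ, pow_mul']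
    have hpow2 : p ^ (2 * N + 2) = (p ^ N) ^ 2 * p ^ 2 := by rw [pow_add, pow_mul']
    have hr : qFactorialInv p ((2 * N : ℕ) : ℤ) = (1 - p ^ (2 * N + 1)) * (1 - p ^ (2 * N + 2)) *
        qFactorialInv p ((2 * (N + 1) : ℕ) : ℤ) := by
      have h1 := step ((2 * (N + 1) : ℕ) : ℤ)
      have h2 := step (((2 * (N + 1) : ℕ) : ℤ) - 1)
      have e1 : ((2 * (N + 1) : ℕ) : ℤ) - 1 = ((2 * N + 1 : ℕ) : ℤ) := by push_cast; ring
      have e2 : ((2 * N + 1 : ℕ) : ℤ) - 1 = ((2 * N : ℕ) : ℤ) := by push_cast; ring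
      rw [e1] at h1 h2
      rw [e2] at h2
      rw [← h2, ← h1, zpow_natCast, zpow_natCast, mul_assoc, mul_add 2 N 1, mul_one]
    have hk : (1 - p ^ (2 * N + 1)) * (1 - p ^ (2 * N + 2)) ≠ 0 := by
      have h1 := one_sub_mul_pow_ne_zero hp1 (2 * N)
      have h2 := one_sub_mul_pow_ne_zero hp1 (2 * N + 1)
      rw [← pow_succ'] at h1 h2
      exact mul_ne_zero h1 h2
    set S : ℤ → ℂ := fun j => qFactorialInv p (N + j) * qFactorialInv p (N - j) * thetaTerm s y j
    have hup : HasSum (fun j => S (j - 1)) P := ih.comp_int_add (-1)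
    have hdn : HasSum (fun j => S (j + 1)) P := ih.comp_int_add 1
    -- Expanding `(1 - y p^N)(1 - p^(N+1)/y)` gives `1 + p^(2N+1) - y p^N - p^(N+1)/y`. The terms
    -- with `y` and `1/y` are paired with shifted copies of the sum, so that powers of `y` match
    -- termwise.
    have key := (((ih.mul_left (1 + p ^ (2 * N + 1))).sub (hup.mul_left (y * p ^ N))).sub
      (hdn.mul_left (p ^ (N + 1) * y⁻¹))).mul_left ((1 - p ^ (2 * N + 1)) * (1 - p ^ (2 * N + 2)))⁻¹
    have cast_sum : ∀ {f g : ℤ → ℂ} {a b : ℂ}, HasSum f a → g = f → b = a → HasSum g b := by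
      rintro f g a b h rfl rfl
      exact h
    refine cast_sum key (funext fun j => ?_) ?_
    · rw [eq_inv_mul_iff_mul_eq₀ hk]
      have a1 := step (N + 1 + j)
      have a2 := step (N + 1 + j - 1)
      have b1 := step (N + 1 - j)
      have b2 := step (N + 1 - j - 1)
      have ej : thetaTerm s y j = -(p ^ (j - 1) * y) * thetaTerm s y (j - 1) := by
        have := thetaTerm_succ hs hy (j - 1)
        rw [sub_add_cancel, zpow_mul] at this
        simpa using this
      have ej1 : thetaTerm s y (j + 1) = -(p ^ j * y) * thetaTerm s y j := by
        have := thetaTerm_succ hs hy j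
        rw [zpow_mul] at this
        simpa using this
      have ej' : y * thetaTerm s y (j - 1) = -(p ^ (-j) * p) * thetaTerm s y j := by
        rw [ej, zpow_sub_one₀ hp, zpow_neg]
        have := zpow_ne_zero j hp
        field_simp
      have ej1' : y⁻¹ * thetaTerm s y (j + 1) = -(p ^ j) * thetaTerm s y j := by
        rw [ej1]; field_simp
      have hA : p ^ ((N : ℤ) + 1 + j) = p ^ N * p * p ^ j := by
        rw [zpow_add₀ hp, zpow_add_one₀ hp, zpow_natCast]
      have hB : p ^ ((N : ℤ) + 1 - j) = p ^ N * p * p ^ (-j) := by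
        rw [sub_eq_add_neg, zpow_add₀ hp, zpow_add_one₀ hp, zpow_natCast]
      have hA' : p ^ ((N : ℤ) + 1 + j - 1) = p ^ N * p ^ j := by
        rw [zpow_sub_one₀ hp, hA]; field_simp
      have hB' : p ^ ((N : ℤ) + 1 - j - 1) = p ^ N * p ^ (-j) := by
        rw [zpow_sub_one₀ hp, hB]; field_simp
      have hAB : p ^ j * p ^ (-j) = 1 := by rw [← zpow_add₀ hp]; simp
      rw [hA] at a1; rw [hA'] at a2; rw [hB] at b1; rw [hB'] at b2
      simp only [S]
      rw [show (N : ℤ) + (j - 1) = N + 1 + j - 1 - 1 by ring,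
        show (N : ℤ) - (j - 1) = N + 1 - j by ring,
        show (N : ℤ) + (j + 1) = N + 1 + j by ring,
        show (N : ℤ) - (j + 1) = N + 1 - j - 1 - 1 by ring,
        show (N : ℤ) + j = N + 1 + j - 1 by ring,
        show (N : ℤ) - j = N + 1 - j - 1 by ring,
        ← a2, ← a1, ← b2, ← b1]
      push_cast
      generalize qFactorialInv p (N + 1 + j) = R
      generalize qFactorialInv p (N + 1 - j) = R'
      have e1 : ∀ X Y Z : ℂ, y * Z * (X * Y * thetaTerm s y (j - 1)) =
          -(p ^ (-j) * p) * thetaTerm s y j * X * Y * Z := by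
        intro X Y Z; rw [← ej']; ring
      have e2 : ∀ X Y Z : ℂ, Z * y⁻¹ * (X * Y * thetaTerm s y (j + 1)) =
          -(p ^ j) * thetaTerm s y j * X * Y * Z := by
        intro X Y Z; rw [← ej1']; ring
      rw [e1, e2]
      generalize thetaTerm s y j = E
      generalize p ^ j = u at *
      generalize p ^ (-j) = v at *
      rw [hpow1, hpow2, pow_succ p N]
      generalize p ^ N = w
      -- With `u = p^j` and `v = p^(-j)`, the termwise identity is polynomial modulo `u v = 1`.
      linear_combination (R * R' * E * (w ^ 2 * p + w ^ 2 * p ^ 2 - w ^ 4 * p ^ 3 * (u * v + 1) +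
        w ^ 2 * p * (1 - w * p * u) * (1 - w * p * v))) * hAB
    · rw [eq_inv_mul_iff_mul_eq₀ hk, hP, hr, Finset.prod_range_succ, Finset.prod_range_succ,
        hpow1, hpow2, pow_succ p N]
      generalize (∏ k ∈ Finset.range N, (1 - y * p ^ k)) = A
      generalize (∏ k ∈ Finset.range N, (1 - p * y⁻¹ * p ^ k)) = B
      generalize qFactorialInv p ((2 * (N + 1) : ℕ) : ℤ) = Q
      generalize p ^ N = w
      linear_combination ((1 - w ^ 2 * p) * (1 - w ^ 2 * p ^ 2)) * A * B * Q * p * w ^ 2 *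
        mul_inv_cancel₀ hy

/-- The Jacobi triple product identity. -/
theorem qTheta_eq_tsum {s y : ℂ} (hs : s ≠ 0) (hs1 : ‖s‖ < 1) (hy : y ≠ 0) :
    qTheta (s ^ 2) y = (qPochInf (s ^ 2) (s ^ 2))⁻¹ * ∑' j, thetaTerm s y j := by
  have hp1 : ‖s ^ 2‖ < 1 := by
    rw [norm_pow]; exact pow_lt_one₀ (norm_nonneg _) hs1 two_ne_zero
  obtain ⟨C, hC0, hC⟩ := exists_norm_qFactorialInv_le hp1
  set ρ := (qPochInf (s ^ 2) (s ^ 2))⁻¹ with hρ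
  have hρ0 : ρ ≠ 0 := inv_ne_zero (qPochInf_self_ne_zero hp1)
  have h1 : Tendsto (fun N : ℕ => ∑' j : ℤ, qFactorialInv (s ^ 2) (N + j) *
      qFactorialInv (s ^ 2) (N - j) * thetaTerm s y j) atTop
      (𝓝 (∑' j : ℤ, ρ * ρ * thetaTerm s y j)) := by
    -- Both reciprocal q-factorials tend to `ρ` for fixed `j`. The product side carries one factor
    -- `ρ`, so one is cancelled at the end.
    refine tendsto_tsum_of_dominated_convergence
      (bound := fun j => C * C * ‖thetaTerm s y j‖)
      ((summable_norm_thetaTerm hs hs1 hy).mul_left _) (fun j => ?_)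
      (Eventually.of_forall fun N j => ?_)
    · refine ((?_ : Tendsto _ _ _).mul (?_ : Tendsto _ _ _)).mul_const _
      · exact (tendsto_qFactorialInv hp1).comp
          (tendsto_atTop_add_const_right _ _ tendsto_natCast_atTop_atTop)
      · simp only [sub_eq_add_neg]
        exact (tendsto_qFactorialInv hp1).comp
          (tendsto_atTop_add_const_right _ _ tendsto_natCast_atTop_atTop)
    · rw [norm_mul, norm_mul]
      gcongr <;> exact hC _
  have h2 := ((tendsto_prod_qPochInf hp1 y).mul (tendsto_prod_qPochInf hp1 (s ^ 2 * y⁻¹))).mul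
    ((tendsto_qFactorialInv_natCast hp1).comp
      (tendsto_id.const_mul_atTop' (two_pos : 0 < 2)))
  have h3 := tendsto_nhds_unique h1 (h2.congr fun N =>
    ((hasSum_finite_tripleProduct hs hs1 hy N).tsum_eq).symm)
  rw [tsum_mul_left] at h3
  rw [qTheta]
  apply mul_right_cancel₀ hρ0
  rw [← h3]; ring

/-! ### The q-Airy series -/

/-- The entire function `∑_{k ≥ 0} (-1)^k s^{k(k-1)} y^k / (s; s)_k`. -/
noncomputable def qAiry (s y : ℂ) : ℂ := ∑' k : ℤ, qFactorialInv s k * thetaTerm s y k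

lemma hasSum_qAiry {s y : ℂ} (hs : s ≠ 0) (hs1 : ‖s‖ < 1) (hy : y ≠ 0) :
    HasSum (fun k : ℤ => qFactorialInv s k * thetaTerm s y k) (qAiry s y) := by
  obtain ⟨C, hC0, hC⟩ := exists_norm_qFactorialInv_le hs1
  refine (Summable.of_norm_bounded ((summable_norm_thetaTerm hs hs1 hy).mul_left C)
    fun k => ?_).hasSum
  rw [norm_mul]
  gcongr
  exact hC _

/-- Termwise, the difference of the values at `s⁻¹y` and `y` carries `s^(-k)(1 - s^k)/(s;s)_k =
s^(-k)/(s;s)_{k-1}`; shifting `k` by one gives the series at `s y`. -/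
lemma qAiry_recurrence {s y : ℂ} (hs : s ≠ 0) (hs1 : ‖s‖ < 1) (hy : y ≠ 0) :
    qAiry s (s⁻¹ * y) = qAiry s y - s⁻¹ * y * qAiry s (s * y) := by
  have h1 := hasSum_qAiry hs hs1 hy
  have h2 := (Equiv.subRight (1 : ℤ)).hasSum_iff.2
    (hasSum_qAiry hs hs1 (mul_ne_zero hs hy))
  have h3 := hasSum_qAiry hs hs1 (mul_ne_zero (inv_ne_zero hs) hy)
  refine h3.unique (((h1.sub (h2.mul_left (s⁻¹ * y)))).congr_fun ?_)
  intro k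
  have hk := one_sub_zpow_mul_qFactorialInv hs1 k
  have hE := thetaTerm_succ hs hy (k - 1)
  rw [sub_add_cancel] at hE
  simp only [Function.comp, Equiv.subRight_apply]
  rw [← hk, thetaTerm_mul, thetaTerm_mul, hE, inv_zpow, mul_sub, zpow_sub₀ hs, zpow_sub_one₀ hs,
    two_mul, zpow_add₀ hs]
  have := zpow_ne_zero k hs
  have e2 : s ^ (2 * 1 : ℤ) = s ^ 2 := by norm_cast
  rw [e2]
  field_simp
  ring

/-- The factor `s^(-2n)` cancels the cross term `2nj` of the quadratic exponent. -/
lemma thetaTerm_shift {s y : ℂ} (hs : s ≠ 0) (hy : y ≠ 0) (n j : ℤ) :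
    thetaTerm s (s ^ (-2 * n) * y) (n + j) =
      (-1) ^ n * s ^ (-n ^ 2 - n) * y ^ n * thetaTerm s y j := by
  have h : (n + j) * (n + j - 1) + -2 * n * (n + j) = (-n ^ 2 - n) + j * (j - 1) := by ring
  have h' := congrArg (fun m : ℤ => s ^ m) h
  beta_reduce at h'
  rw [zpow_add₀ hs, zpow_add₀ hs] at h'
  rw [thetaTerm, thetaTerm, mul_zpow, ← zpow_mul, zpow_add₀ (by norm_num : (-1 : ℂ) ≠ 0) n j,
    zpow_add₀ hy n j]
  linear_combination (-1) ^ n * (-1) ^ j * y ^ n * y ^ j * h'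

lemma qAiry_shift {s y : ℂ} (hs : s ≠ 0) (hy : y ≠ 0) (n : ℤ) :
    qAiry s (s ^ (-2 * n) * y) = (-1) ^ n * s ^ (-n ^ 2 - n) * y ^ n *
      ∑' j : ℤ, qFactorialInv s (n + j) * thetaTerm s y j := by
  rw [qAiry, ← (Equiv.addLeft n).tsum_eq, ← tsum_mul_left]
  refine tsum_congr fun j => ?_
  rw [Equiv.coe_addLeft, thetaTerm_shift hs hy]
  ring

lemma tendsto_tsum_qFactorialInv_mul_thetaTerm {s y : ℂ} (hs : s ≠ 0) (hs1 : ‖s‖ < 1)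
    (hy : y ≠ 0) :
    Tendsto (fun n : ℕ => ∑' j : ℤ, qFactorialInv s (n + j) * thetaTerm s y j) atTop
      (𝓝 ((qPochInf s s)⁻¹ * ∑' j, thetaTerm s y j)) := by
  obtain ⟨C, hC0, hC⟩ := exists_norm_qFactorialInv_le hs1
  rw [← tsum_mul_left]
  refine tendsto_tsum_of_dominated_convergence
      ((summable_norm_thetaTerm hs hs1 hy).mul_left C) (fun j => ?_)
      (Eventually.of_forall fun N j => ?_)
  · exact ((tendsto_qFactorialInv hs1).comp
      (tendsto_atTop_add_const_right _ _ tendsto_natCast_atTop_atTop)).mul_const _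
  · rw [norm_mul]
    gcongr
    exact hC _

/-- Only `k = 0` survives in the limit. Terms with `k < 0` vanish, and for `k ≥ 0` the extra factor
`s^(mk)` has norm at most one, so the series at `y` dominates. -/
lemma tendsto_qAiry_pow_mul {s y : ℂ} (hs : s ≠ 0) (hs1 : ‖s‖ < 1) (hy : y ≠ 0) :
    Tendsto (fun m : ℕ => qAiry s (s ^ m * y)) atTop (𝓝 1) := by
  obtain ⟨C, hC0, hC⟩ := exists_norm_qFactorialInv_le hs1
  have h1 : ∑' k : ℤ, (if k = 0 then (1 : ℂ) else 0) = 1 := tsum_ite_eq 0 _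
  rw [← h1]
  refine tendsto_tsum_of_dominated_convergence
      ((summable_norm_thetaTerm hs hs1 hy).mul_left C) (fun k => ?_)
      (Eventually.of_forall fun m k => ?_)
  · rcases lt_trichotomy k 0 with h | h | h
    · simp [qFactorialInv_of_neg s h, h.ne]
    · simp [h, qFactorialInv_zero, thetaTerm]
    · obtain ⟨n, rfl⟩ := Int.eq_ofNat_of_zero_le h.le
      simp only [h.ne', if_false, thetaTerm_mul]
      have h0 : Tendsto (fun m : ℕ => (s ^ n) ^ m) atTop (𝓝 0) := by
        refine tendsto_pow_atTop_nhds_zero_of_norm_lt_one ?_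
        rw [norm_pow]
        exact pow_lt_one₀ (norm_nonneg _) hs1 (by omega)
      have h2 := (h0.mul_const (thetaTerm s y n)).const_mul (qFactorialInv s n)
      rw [zero_mul, mul_zero] at h2
      refine h2.congr fun m => ?_
      rw [zpow_natCast, ← pow_mul, ← pow_mul, mul_comm n m]
  · rcases lt_or_ge k 0 with h | h
    · rw [qFactorialInv_of_neg s h, zero_mul, norm_zero]
      positivity
    · obtain ⟨n, rfl⟩ := Int.eq_ofNat_of_zero_le h
      rw [thetaTerm_mul, norm_mul, norm_mul, zpow_natCast, norm_pow, norm_pow]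
      have h3 : (‖s‖ ^ m) ^ n ≤ 1 :=
        pow_le_one₀ (by positivity) (pow_le_one₀ (norm_nonneg _) hs1.le)
      have h4 := hC n
      calc _ ≤ C * (1 * ‖thetaTerm s y n‖) := by gcongr
        _ = _ := by rw [one_mul]

/-! ### The decaying solution and its asymptotics -/

/-- The solution of `ψ_{n+1} = x q^n ψ_n - q ψ_{n-1}` that decays at `-∞`. -/
noncomputable def eigenSeq (q x : ℂ) (n : ℤ) : ℂ :=
  x ^ n * q ^ (n * (n - 1) / 2) * qAiry (q ^ 2) (q ^ (4 - 2 * n) * (x ^ 2)⁻¹)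

lemma norm_sq_lt_one {q : ℂ} (hq1 : ‖q‖ < 1) : ‖q ^ 2‖ < 1 := by
  rw [norm_pow]; exact pow_lt_one₀ (norm_nonneg _) hq1 two_ne_zero

lemma eigenSeq_recurrence {q x : ℂ} (hq : q ≠ 0) (hq1 : ‖q‖ < 1) (hx : x ≠ 0) (n : ℤ) :
    eigenSeq q x (n + 1) = x * q ^ n * eigenSeq q x n - q * eigenSeq q x (n - 1) := by
  have hT1 : (n + 1) * (n + 1 - 1) / 2 = n * (n - 1) / 2 + n := by
    rw [show (n + 1) * (n + 1 - 1) = n * (n - 1) + n * 2 by ring,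
      Int.add_mul_ediv_right _ _ two_ne_zero]
  have hT2 : (n - 1) * (n - 1 - 1) / 2 = n * (n - 1) / 2 + (1 - n) := by
    rw [show (n - 1) * (n - 1 - 1) = n * (n - 1) + (1 - n) * 2 by ring,
      Int.add_mul_ediv_right _ _ two_ne_zero]
  set y := q ^ (4 - 2 * n) * (x ^ 2)⁻¹ with hy
  have hy0 : y ≠ 0 := mul_ne_zero (zpow_ne_zero _ hq) (inv_ne_zero (pow_ne_zero _ hx))
  have hy1 : q ^ (4 - 2 * (n + 1)) * (x ^ 2)⁻¹ = (q ^ 2)⁻¹ * y := by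
    rw [hy, show 4 - 2 * (n + 1) = 4 - 2 * n - 2 by ring, zpow_sub₀ hq _ 2, zpow_ofNat]
    ring
  have hy2 : q ^ (4 - 2 * (n - 1)) * (x ^ 2)⁻¹ = q ^ 2 * y := by
    rw [hy, show 4 - 2 * (n - 1) = 4 - 2 * n + 2 by ring, zpow_add₀ hq _ 2, zpow_ofNat]
    ring
  rw [eigenSeq, eigenSeq, eigenSeq, hT1, hT2, hy1, hy2, ← hy,
    qAiry_recurrence (pow_ne_zero 2 hq) (norm_sq_lt_one hq1) hy0, zpow_add₀ hq _ n,
    zpow_add₀ hq _ (1 - n), zpow_add_one₀ hx, zpow_sub_one₀ hx]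
  have hy3 : x * q ^ n * ((q ^ 2)⁻¹ * y) = q * x⁻¹ * q ^ (1 - n) := by
    rw [hy, zpow_sub₀ hq, zpow_sub₀ hq, two_mul, zpow_add₀ hq, zpow_one, zpow_ofNat]
    have := zpow_ne_zero n hq
    field_simp
  linear_combination (-(x ^ n * q ^ (n * (n - 1) / 2) * qAiry (q ^ 2) (q ^ 2 * y))) * hy3

lemma eigenSeq_even {q x : ℂ} (hq : q ≠ 0) (hx : x ≠ 0) (n : ℤ) :
    eigenSeq q x (2 * n) = (-1) ^ n * q ^ n *
      ∑' j : ℤ, qFactorialInv (q ^ 2) (n + j) * thetaTerm (q ^ 2) ((q ^ 2) ^ 2 * (x ^ 2)⁻¹) j := by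
  have hT : 2 * n * (2 * n - 1) / 2 = n * (2 * n - 1) := by
    rw [mul_assoc, Int.mul_ediv_cancel_left _ two_ne_zero]
  have hs : q ^ 2 ≠ 0 := pow_ne_zero 2 hq
  have hy : q ^ (4 - 2 * (2 * n)) * (x ^ 2)⁻¹ =
      (q ^ 2) ^ (-2 * n) * ((q ^ 2) ^ 2 * (x ^ 2)⁻¹) := by
    rw [show (4 - 2 * (2 * n)) = 2 * (-2 * n) + 4 by ring, zpow_add₀ hq, zpow_mul, zpow_ofNat,
      zpow_ofNat]
    ring
  rw [eigenSeq, hT, hy, qAiry_shift hs (mul_ne_zero (pow_ne_zero _ hs)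
    (inv_ne_zero (pow_ne_zero _ hx)))]
  generalize ∑' j : ℤ, qFactorialInv (q ^ 2) (n + j) *
    thetaTerm (q ^ 2) ((q ^ 2) ^ 2 * (x ^ 2)⁻¹) j = S
  -- All quadratic exponents of `q` cancel, leaving the growth rate `q^n` that the boundary
  -- conditions normalise away.
  have hexp : q ^ (n * (2 * n - 1)) * (q ^ 2) ^ (-n ^ 2 - n) * ((q ^ 2) ^ 2) ^ n = q ^ n := by
    simp only [← zpow_natCast, ← zpow_mul, ← zpow_add₀ hq]
    congr 1
    push_cast
    ring
  have hxx : x ^ (2 * n) * ((x ^ 2)⁻¹) ^ n = 1 := by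
    rw [zpow_mul, zpow_ofNat, ← mul_zpow, mul_inv_cancel₀ (pow_ne_zero _ hx), one_zpow]
  rw [mul_zpow, ← hexp]
  linear_combination ((-1) ^ n * S * (q ^ (n * (2 * n - 1)) * (q ^ 2) ^ (-n ^ 2 - n) *
    ((q ^ 2) ^ 2) ^ n)) * hxx

lemma eigenSeq_odd {q x : ℂ} (hq : q ≠ 0) (hx : x ≠ 0) (n : ℤ) :
    eigenSeq q x (2 * n + 1) = (-1) ^ n * q ^ n * (x *
      ∑' j : ℤ, qFactorialInv (q ^ 2) (n + j) * thetaTerm (q ^ 2) (q ^ 2 * (x ^ 2)⁻¹) j) := by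
  have hT : (2 * n + 1) * (2 * n + 1 - 1) / 2 = n * (2 * n + 1) := by
    rw [show (2 * n + 1) * (2 * n + 1 - 1) = 2 * (n * (2 * n + 1)) by ring,
      Int.mul_ediv_cancel_left _ two_ne_zero]
  have hs : q ^ 2 ≠ 0 := pow_ne_zero 2 hq
  have hy : q ^ (4 - 2 * (2 * n + 1)) * (x ^ 2)⁻¹ =
      (q ^ 2) ^ (-2 * n) * (q ^ 2 * (x ^ 2)⁻¹) := by
    rw [show (4 - 2 * (2 * n + 1)) = 2 * (-2 * n) + 2 by ring, zpow_add₀ hq, zpow_mul, zpow_ofNat]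
    ring
  rw [eigenSeq, hT, hy, qAiry_shift hs (mul_ne_zero hs (inv_ne_zero (pow_ne_zero _ hx)))]
  generalize ∑' j : ℤ, qFactorialInv (q ^ 2) (n + j) *
    thetaTerm (q ^ 2) (q ^ 2 * (x ^ 2)⁻¹) j = S
  have hexp : q ^ (n * (2 * n + 1)) * (q ^ 2) ^ (-n ^ 2 - n) * (q ^ 2) ^ n = q ^ n := by
    simp only [← zpow_natCast, ← zpow_mul, ← zpow_add₀ hq]
    congr 1
    push_cast
    ring
  have hxx : x ^ (2 * n) * ((x ^ 2)⁻¹) ^ n = 1 := by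
    rw [zpow_mul, zpow_ofNat, ← mul_zpow, mul_inv_cancel₀ (pow_ne_zero _ hx), one_zpow]
  rw [mul_zpow, ← hexp, zpow_add_one₀ hx]
  linear_combination ((-1) ^ n * S * x * (q ^ (n * (2 * n + 1)) * (q ^ 2) ^ (-n ^ 2 - n) *
    (q ^ 2) ^ n)) * hxx

/-- The common nonzero factor relating the boundary values of `eigenSeq` to theta functions. -/
noncomputable def boundaryConst (q : ℂ) : ℂ :=
  (qPochInf (q ^ 2) (q ^ 2))⁻¹ * qPochInf (q ^ 4) (q ^ 4)

lemma boundaryConst_ne_zero {q : ℂ} (hq1 : ‖q‖ < 1) : boundaryConst q ≠ 0 := by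
  refine mul_ne_zero (inv_ne_zero (qPochInf_self_ne_zero (norm_sq_lt_one hq1)))
    (qPochInf_self_ne_zero ?_)
  rw [norm_pow]; exact pow_lt_one₀ (norm_nonneg _) hq1 four_ne_zero

/-- The reflection `j ↦ -j` replaces `s² y⁻¹` by `y` in the series with `s = q²`; the triple product
then has base `s² = q⁴`. -/
lemma tsum_thetaTerm_eq_qTheta {q y : ℂ} (hq : q ≠ 0) (hq1 : ‖q‖ < 1) (hy : y ≠ 0) :
    (qPochInf (q ^ 2) (q ^ 2))⁻¹ * ∑' j, thetaTerm (q ^ 2) ((q ^ 2) ^ 2 * y⁻¹) j =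
      boundaryConst q * qTheta (q ^ 4) y := by
  have hs : q ^ 2 ≠ 0 := pow_ne_zero 2 hq
  have h4 : q ^ 4 = (q ^ 2) ^ 2 := by ring
  have h := qPochInf_self_ne_zero (norm_sq_lt_one (norm_sq_lt_one hq1))
  rw [tsum_thetaTerm_inv hs, boundaryConst, h4, qTheta_eq_tsum hs (norm_sq_lt_one hq1) hy, mul_assoc,
    mul_inv_cancel_left₀ h]

lemma tendsto_eigenSeq_even {q x : ℂ} (hq : q ≠ 0) (hq1 : ‖q‖ < 1) (hx : x ≠ 0) :
    Tendsto (fun n : ℕ => (-1) ^ n * (q ^ (-(n : ℤ)) * eigenSeq q x (2 * n))) atTop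
      (𝓝 (boundaryConst q * qTheta (q ^ 4) (x ^ 2))) := by
  have hs : q ^ 2 ≠ 0 := pow_ne_zero 2 hq
  have hx2 : x ^ 2 ≠ 0 := pow_ne_zero 2 hx
  rw [← tsum_thetaTerm_eq_qTheta hq hq1 hx2]
  refine (tendsto_tsum_qFactorialInv_mul_thetaTerm hs (norm_sq_lt_one hq1)
    (mul_ne_zero (pow_ne_zero 2 hs) (inv_ne_zero hx2))).congr fun n => ?_
  have h1 : (-1 : ℂ) ^ n * (-1) ^ n = 1 := by rw [← mul_pow]; norm_num
  rw [eigenSeq_even hq hx, zpow_neg, zpow_natCast, zpow_natCast]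
  generalize ∑' j : ℤ, qFactorialInv (q ^ 2) (n + j) *
    thetaTerm (q ^ 2) ((q ^ 2) ^ 2 * (x ^ 2)⁻¹) j = S
  linear_combination (-S) * h1 - S * ((-1) ^ n * (-1) ^ n) * inv_mul_cancel₀ (pow_ne_zero n hq)

lemma tendsto_eigenSeq_odd {q x : ℂ} (hq : q ≠ 0) (hq1 : ‖q‖ < 1) (hx : x ≠ 0) :
    Tendsto (fun n : ℕ => (-1) ^ n * (q ^ (-(n : ℤ)) * eigenSeq q x (2 * n + 1))) atTop
      (𝓝 (boundaryConst q * (x * qTheta (q ^ 4) (q ^ 2 * x ^ 2)))) := by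
  have hs : q ^ 2 ≠ 0 := pow_ne_zero 2 hq
  have hx2 : x ^ 2 ≠ 0 := pow_ne_zero 2 hx
  have hy : (q ^ 2) ^ 2 * (q ^ 2 * x ^ 2)⁻¹ = q ^ 2 * (x ^ 2)⁻¹ := by field_simp
  have h0 := tsum_thetaTerm_eq_qTheta hq hq1 (mul_ne_zero hs hx2)
  rw [hy] at h0
  rw [mul_left_comm, ← h0]
  refine ((tendsto_tsum_qFactorialInv_mul_thetaTerm hs (norm_sq_lt_one hq1)
    (mul_ne_zero hs (inv_ne_zero hx2))).const_mul x).congr fun n => ?_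
  have h1 : (-1 : ℂ) ^ n * (-1) ^ n = 1 := by rw [← mul_pow]; norm_num
  rw [eigenSeq_odd hq hx, zpow_neg, zpow_natCast, zpow_natCast]
  generalize ∑' j : ℤ, qFactorialInv (q ^ 2) (n + j) *
    thetaTerm (q ^ 2) (q ^ 2 * (x ^ 2)⁻¹) j = S
  linear_combination (-(x * S)) * h1 -
    x * S * ((-1) ^ n * (-1) ^ n) * inv_mul_cancel₀ (pow_ne_zero n hq)

lemma tendsto_qAiry_eigenSeq {q x : ℂ} (hq : q ≠ 0) (hq1 : ‖q‖ < 1) (hx : x ≠ 0) :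
    Tendsto (fun m : ℕ => qAiry (q ^ 2) (q ^ (4 - 2 * (-(m : ℤ))) * (x ^ 2)⁻¹)) atTop (𝓝 1) := by
  refine (tendsto_qAiry_pow_mul (pow_ne_zero 2 hq) (norm_sq_lt_one hq1)
    (y := q ^ 4 * (x ^ 2)⁻¹) (by positivity)).congr fun m => ?_
  congr 1
  rw [show (4 - 2 * (-(m : ℤ))) = ((2 * m + 4 : ℕ) : ℤ) by push_cast; ring, zpow_natCast]
  ring

lemma eigenSeq_ne_zero {q x : ℂ} (hq : q ≠ 0) (hq1 : ‖q‖ < 1) (hx : x ≠ 0) :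
    eigenSeq q x ≠ 0 := by
  obtain ⟨m, hm⟩ := ((tendsto_qAiry_eigenSeq hq hq1 hx).eventually_ne one_ne_zero).exists
  intro h
  have h1 := congrFun h (-(m : ℤ))
  exact mul_ne_zero (mul_ne_zero (zpow_ne_zero _ hx) (zpow_ne_zero _ hq)) hm h1

lemma summable_norm_sq_of_tendsto {q : ℂ} (hq : q ≠ 0) (hq1 : ‖q‖ < 1) {f : ℕ → ℂ} {L : ℂ}
    (h : Tendsto (fun n : ℕ => (-1) ^ n * (q ^ (-(n : ℤ)) * f n)) atTop (𝓝 L)) :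
    Summable fun n => ‖f n‖ ^ 2 := by
  obtain ⟨C, hC⟩ := h.norm.bddAbove_range
  have hC' : ∀ n : ℕ, ‖f n‖ ≤ ‖q‖ ^ n * C := by
    intro n
    have h1 : ‖(-1) ^ n * (q ^ (-(n : ℤ)) * f n)‖ ≤ C := hC ⟨n, rfl⟩
    have h2 : 0 < ‖q‖ ^ n := pow_pos (norm_pos_iff.2 hq) n
    rw [norm_mul, norm_mul, norm_pow, norm_neg, norm_one, one_pow, one_mul, zpow_neg, zpow_natCast,
      norm_inv, norm_pow] at h1
    rwa [← inv_mul_le_iff₀ h2]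
  refine Summable.of_nonneg_of_le (fun n => by positivity) (fun n => ?_)
    ((summable_geometric_of_lt_one (r := ‖q‖ ^ 2) (by positivity)
      (pow_lt_one₀ (norm_nonneg _) hq1 two_ne_zero)).mul_right (C ^ 2))
  calc ‖f n‖ ^ 2 ≤ (‖q‖ ^ n * C) ^ 2 := by gcongr; exact hC' n
    _ = _ := by ring

lemma memℓp_eigenSeq {q x : ℂ} (hq : q ≠ 0) (hq1 : ‖q‖ < 1) (hx : x ≠ 0) :
    Memℓp (eigenSeq q x) 2 := by
  refine memℓp_gen ?_
  simp only [ENNReal.toReal_ofNat, Real.rpow_ofNat]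
  refine Summable.of_nat_of_neg ?_ ?_
  · have he := summable_norm_sq_of_tendsto hq hq1 (tendsto_eigenSeq_even hq hq1 hx)
    have ho := summable_norm_sq_of_tendsto hq hq1 (tendsto_eigenSeq_odd hq hq1 hx)
    exact (HasSum.even_add_odd (f := fun n : ℕ => ‖eigenSeq q x n‖ ^ 2)
      (by simpa using he.hasSum) (by simpa using ho.hasSum)).summable
  · obtain ⟨C, hC⟩ := (tendsto_qAiry_eigenSeq hq hq1 hx).norm.bddAbove_range
    refine Summable.of_nonneg_of_le (fun n => by positivity) (fun m => ?_)
      ((summable_norm_thetaTerm_natCast (y := q ^ 2 * (x ^ 2)⁻¹) hq hq1 (by positivity)).mul_right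
        (C ^ 2))
    have hm : ‖qAiry (q ^ 2) (q ^ (4 - 2 * (-(m : ℤ))) * (x ^ 2)⁻¹)‖ ≤ C := hC ⟨m, rfl⟩
    -- The squared prefactor at `-m` is itself a theta term in modulus, so its summability is
    -- already known.
    have hpre : ‖x ^ (-(m : ℤ)) * q ^ (-(m : ℤ) * (-(m : ℤ) - 1) / 2)‖ ^ 2 =
        ‖thetaTerm q (q ^ 2 * (x ^ 2)⁻¹) m‖ := by
      have h2 : -(m : ℤ) * (-(m : ℤ) - 1) / 2 * 2 = m * (m - 1) + 2 * m := by
        have : 2 ∣ -(m : ℤ) * (-(m : ℤ) - 1) := (Int.even_mul_pred_self _).two_dvd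
        rw [Int.ediv_mul_cancel this]; ring
      rw [← norm_pow, mul_pow, ← zpow_natCast (q ^ _) 2, ← zpow_mul]
      push_cast
      rw [h2, zpow_add₀ hq, zpow_mul q 2 (m : ℤ), thetaTerm, zpow_neg]
      simp only [norm_mul, norm_zpow, norm_neg, norm_one, norm_inv, norm_pow, zpow_ofNat,
        zpow_natCast]
      simp only [mul_pow, inv_pow, one_pow, one_mul]
      ring
    calc ‖eigenSeq q x (-(m : ℤ))‖ ^ 2 = ‖thetaTerm q (q ^ 2 * (x ^ 2)⁻¹) m‖ *
          ‖qAiry (q ^ 2) (q ^ (4 - 2 * (-(m : ℤ))) * (x ^ 2)⁻¹)‖ ^ 2 := by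
            rw [← hpre, ← mul_pow, ← norm_mul]; rfl
      _ ≤ _ := by gcongr

/-! ### Wronskians and uniqueness of square summable solutions -/

/-- Iterating backwards gives `f n = c^m f(n - m d)`, which tends to `0` as `m → ∞`. -/
lemma eq_zero_of_bounded_of_shift {f : ℤ → ℂ} {c : ℂ} {d : ℤ} {B : ℝ} (hc : ‖c‖ < 1)
    (hB : ∀ n, ‖f n‖ ≤ B) (hf : ∀ n, f (n + d) = c * f n) (n : ℤ) : f n = 0 := by
  have h1 : ∀ m : ℕ, f n = c ^ m * f (n - m * d) := by
    intro m
    induction m with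
    | zero => simp
    | succ m ih =>
      rw [ih, show n - m * d = n - ((m + 1 : ℕ) : ℤ) * d + d by push_cast; ring, hf]
      ring
  have h2 : ∀ m : ℕ, ‖f n‖ ≤ ‖c‖ ^ m * B := by
    intro m
    rw [h1 m, norm_mul, norm_pow]
    gcongr
    exact hB _
  have h3 := (tendsto_pow_atTop_nhds_zero_of_lt_one (norm_nonneg c) hc).mul_const B
  rw [zero_mul] at h3
  exact norm_le_zero_iff.1 (ge_of_tendsto' h3 h2)

lemma jacobiExpr_eq_smul_iff {q : ℝ} (hq : 0 < q) {x : ℂ} {ψ : ℤ → ℂ} :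
    jacobiExpr q ψ = x • ψ ↔
      ∀ n, ψ (n + 1) = x * (q : ℂ) ^ n * ψ n - (q : ℂ) * ψ (n - 1) := by
  have hq' : (q : ℂ) ≠ 0 := by exact_mod_cast hq.ne'
  rw [funext_iff]
  refine forall_congr' fun n => ?_
  have hn := zpow_ne_zero n hq'
  simp only [jacobiExpr, LinearMap.coe_mk, AddHom.coe_mk, Pi.smul_apply, smul_eq_mul,
    zpow_add_one₀ hq', zpow_neg]
  constructor
  · intro h
    field_simp at h
    linear_combination h
  · intro h
    rw [h]
    field_simp
    ring

/-- The discrete Wronskian of two sequences. -/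
def wronskian (ψ χ : ℤ → ℂ) (n : ℤ) : ℂ := ψ (n + 1) * χ n - ψ n * χ (n + 1)

lemma wronskian_succ {q x z : ℂ} {ψ χ : ℤ → ℂ}
    (hψ : ∀ n, ψ (n + 1) = x * q ^ n * ψ n - q * ψ (n - 1))
    (hχ : ∀ n, χ (n + 1) = z * q ^ n * χ n - q * χ (n - 1)) (n : ℤ) :
    wronskian ψ χ (n + 1) =
      q * wronskian ψ χ n + (x - z) * q ^ (n + 1) * (ψ (n + 1) * χ (n + 1)) := by
  have h1 := hψ (n + 1)
  have h2 := hχ (n + 1)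
  rw [add_sub_cancel_right] at h1 h2
  rw [wronskian, wronskian, h1, h2]
  ring

lemma Memℓp.exists_bound {ψ : ℤ → ℂ} (h : Memℓp ψ 2) : ∃ B : ℝ, ∀ n, ‖ψ n‖ ≤ B := by
  obtain ⟨B, hB⟩ := (h.of_exponent_ge le_top).bddAbove
  exact ⟨B, fun n => hB ⟨n, rfl⟩⟩

lemma exists_norm_wronskian_le {ψ χ : ℤ → ℂ} (hψ : Memℓp ψ 2) (hχ : Memℓp χ 2) :
    ∃ B : ℝ, ∀ n, ‖wronskian ψ χ n‖ ≤ B := by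
  obtain ⟨B, hB⟩ := hψ.exists_bound
  obtain ⟨C, hC⟩ := hχ.exists_bound
  have hB0 : 0 ≤ B := (norm_nonneg _).trans (hB 0)
  refine ⟨B * C + B * C, fun n => (norm_sub_le _ _).trans ?_⟩
  rw [norm_mul, norm_mul]
  gcongr <;> first | exact hB _ | exact hC _

lemma eq_zero_of_consecutive_zeros {q x : ℂ} (hq : q ≠ 0) {f : ℤ → ℂ}
    (hf : ∀ n, f (n + 1) = x * q ^ n * f n - q * f (n - 1)) {n₀ : ℤ} (h0 : f n₀ = 0)
    (h1 : f (n₀ + 1) = 0) : f = 0 := by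
  have key : ∀ n, f n = 0 ∧ f (n + 1) = 0 := by
    intro n
    induction n using Int.inductionOn' (b := n₀) with
    | zero => exact ⟨h0, h1⟩
    | succ k _ ih =>
      have h := hf (k + 1)
      rw [add_sub_cancel_right, ih.1, ih.2] at h
      exact ⟨ih.2, by simpa using h⟩
    | pred k _ ih =>
      have h := hf k
      rw [ih.1, ih.2] at h
      have h' : f (k - 1) = 0 := by simpa [hq] using h
      exact ⟨h', by simpa using ih.1⟩
  exact funext fun n => (key n).1

/-- Two square summable solutions of the recurrence are linearly dependent. -/
lemma exists_eq_smul_of_recurrence {q x : ℂ} (hq : q ≠ 0) (hq1 : ‖q‖ < 1) {ψ χ : ℤ → ℂ}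
    (hψ : ∀ n, ψ (n + 1) = x * q ^ n * ψ n - q * ψ (n - 1))
    (hχ : ∀ n, χ (n + 1) = x * q ^ n * χ n - q * χ (n - 1))
    (hψ2 : Memℓp ψ 2) (hχ2 : Memℓp χ 2) (hψ0 : ψ ≠ 0) : ∃ c : ℂ, χ = c • ψ := by
  obtain ⟨B, hB⟩ := exists_norm_wronskian_le hψ2 hχ2
  have hW := eq_zero_of_bounded_of_shift (d := 1) hq1 hB fun n => by
    rw [wronskian_succ hψ hχ, sub_self, zero_mul, zero_mul, add_zero]
  obtain ⟨n₀, hn₀⟩ := Function.ne_iff.1 hψ0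
  rw [Pi.zero_apply] at hn₀
  -- This multiple of `ψ` agrees with `χ` at `n₀`; the vanishing Wronskian then forces agreement at
  -- `n₀ + 1`.
  refine ⟨χ n₀ / ψ n₀, sub_eq_zero.1 (eq_zero_of_consecutive_zeros (x := x) (n₀ := n₀) hq ?_ ?_ ?_)⟩
  · intro n
    simp only [Pi.sub_apply, Pi.smul_apply, smul_eq_mul]
    rw [hψ n, hχ n]
    ring
  · simp [hn₀]
  · have h := hW n₀
    rw [wronskian] at h
    simp only [Pi.sub_apply, Pi.smul_apply, smul_eq_mul]
    field_simp
    linear_combination -h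

lemma eq_zero_of_recurrence_zero {q : ℂ} (hq1 : ‖q‖ < 1) {ψ : ℤ → ℂ}
    (hψ : ∀ n, ψ (n + 1) = 0 * q ^ n * ψ n - q * ψ (n - 1)) (hψ2 : Memℓp ψ 2) : ψ = 0 := by
  obtain ⟨B, hB⟩ := hψ2.exists_bound
  refine funext (eq_zero_of_bounded_of_shift (c := -q) (d := 2) (by rwa [norm_neg]) hB fun n => ?_)
  have h := hψ (n + 1)
  rw [add_sub_cancel_right, add_assoc] at h
  norm_num at h
  rw [h]; ring

/-! ### Reality of the spectral parameter -/

/-- The Green formula: a square summable solution whose Wronskian with its conjugate is negligible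
along a subsequence tending to `+∞` belongs to a real spectral parameter. -/
lemma im_eq_zero_of_tendsto_wronskian {q : ℝ} (hq : 0 < q) (hq1 : q < 1) {x : ℂ} {ψ : ℤ → ℂ}
    (hψ : ∀ n, ψ (n + 1) = x * (q : ℂ) ^ n * ψ n - (q : ℂ) * ψ (n - 1))
    (hψ2 : Memℓp ψ 2) (hψ0 : ψ ≠ 0)
    (hW : Tendsto (fun n : ℕ => (q : ℂ) ^ (-(2 * n : ℤ)) *
      wronskian ψ (fun k => (starRingEnd ℂ) (ψ k)) (2 * n)) atTop (𝓝 0)) : x.im = 0 := by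
  by_contra him
  have hq' : (q : ℂ) ≠ 0 := by exact_mod_cast hq.ne'
  set χ : ℤ → ℂ := fun k => (starRingEnd ℂ) (ψ k) with hχdef
  have hχ : ∀ n, χ (n + 1) = (starRingEnd ℂ) x * (q : ℂ) ^ n * χ n - (q : ℂ) * χ (n - 1) := by
    intro n
    simp only [hχdef, hψ n, map_sub, map_mul, map_zpow₀, Complex.conj_ofReal]
  have hχ2 : Memℓp χ 2 := by
    refine memℓp_gen ?_
    simpa [hχdef] using hψ2.summable (by norm_num)
  set δ := x - (starRingEnd ℂ) x with hδ
  have hδ0 : δ ≠ 0 := by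
    intro h
    exact him (Complex.conj_eq_iff_im.1 (sub_eq_zero.1 h).symm)
  -- Normalised so that the increment from `n` to `n + 1` is exactly `‖ψ (n + 1)‖²`.
  set D : ℤ → ℂ := fun n => δ⁻¹ * ((q : ℂ) ^ (-n) * wronskian ψ χ n) with hD
  have hstep : ∀ n, D (n + 1) = D n + ((‖ψ (n + 1)‖ ^ 2 : ℝ) : ℂ) := by
    intro n
    have hn : ((‖ψ (n + 1)‖ ^ 2 : ℝ) : ℂ) = ψ (n + 1) * χ (n + 1) := by
      rw [hχdef, Complex.mul_conj']
      push_cast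
      rfl
    simp only [hD]
    rw [hn, wronskian_succ hψ hχ, ← hδ, zpow_neg, zpow_neg, zpow_add_one₀ hq']
    have := zpow_ne_zero n hq'
    field_simp
  have hre : ∀ n, (D (n + 1)).re = (D n).re + ‖ψ (n + 1)‖ ^ 2 := by
    intro n
    rw [hstep, Complex.add_re, Complex.ofReal_re]
  have hmono : Monotone fun n => (D n).re := monotone_int_of_le_succ fun n => by
    rw [hre]
    exact le_add_of_nonneg_right (by positivity)
  obtain ⟨B, hB⟩ := exists_norm_wronskian_le hψ2 hχ2
  have htop : Tendsto (fun n : ℕ => (D (2 * n)).re) atTop (𝓝 0) := by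
    have h := (Complex.continuous_re.tendsto _).comp (hW.const_mul δ⁻¹)
    rw [mul_zero, Complex.zero_re] at h
    exact h
  have hbot : Tendsto (fun m : ℕ => (D (-(m : ℤ))).re) atTop (𝓝 0) := by
    have h0 : Tendsto (fun m : ℕ => ‖δ⁻¹‖ * (q ^ m * B)) atTop (𝓝 (‖δ⁻¹‖ * (0 * B))) :=
      ((tendsto_pow_atTop_nhds_zero_of_lt_one hq.le hq1).mul_const B).const_mul _
    rw [zero_mul, mul_zero] at h0
    refine squeeze_zero_norm (fun m => ?_) h0
    refine (Complex.abs_re_le_norm _).trans ?_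
    simp only [hD, neg_neg, zpow_natCast]
    rw [norm_mul, norm_mul, norm_pow, Complex.norm_real, Real.norm_of_nonneg hq.le]
    gcongr
    exact hB _
  -- A monotone sequence tending to `0` at both ends vanishes identically; by monotonicity the even
  -- subsequence suffices at `+∞`.
  have hzero : ∀ n, (D n).re = 0 := by
    intro n
    refine le_antisymm (ge_of_tendsto htop ?_) (le_of_tendsto hbot ?_)
    · filter_upwards [eventually_ge_atTop n.toNat] with m hm
      exact hmono (by omega)
    · filter_upwards [eventually_ge_atTop n.natAbs] with m hm
      exact hmono (by omega)
  refine hψ0 (funext fun n => ?_)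
  have h := hre (n - 1)
  rw [hzero, hzero, sub_add_cancel, zero_add] at h
  exact norm_eq_zero.1 (pow_eq_zero_iff two_ne_zero |>.1 h.symm)

/-! ### Boundary conditions and theta functions -/

lemma tendsto_zero_iff_of_tendsto_signed {f : ℕ → ℂ} {L : ℂ}
    (h : Tendsto (fun n : ℕ => (-1) ^ n * f n) atTop (𝓝 L)) : Tendsto f atTop (𝓝 0) ↔ L = 0 := by
  have hn : ∀ n, ‖(-1) ^ n * f n‖ = ‖f n‖ := fun n => by simp
  constructor
  · intro hf
    refine tendsto_nhds_unique h (tendsto_zero_iff_norm_tendsto_zero.2 ?_)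
    simpa only [hn] using tendsto_zero_iff_norm_tendsto_zero.1 hf
  · rintro rfl
    refine tendsto_zero_iff_norm_tendsto_zero.2 ?_
    simpa only [hn] using tendsto_zero_iff_norm_tendsto_zero.1 h

lemma boundaryCond_infty_iff (q : ℝ) (ψ : ℤ → ℂ) : boundaryCond q OnePoint.infty ψ ↔
    Tendsto (fun n : ℕ => (q : ℂ) ^ (-(n : ℤ)) * ψ (2 * n)) atTop (𝓝 0) := Iff.rfl

lemma boundaryCond_coe_iff (q t : ℝ) (ψ : ℤ → ℂ) : boundaryCond q (t : OnePoint ℝ) ψ ↔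
    Tendsto (fun n : ℕ => (q : ℂ) ^ (-(n : ℤ)) * (ψ (2 * n + 1) + (t : ℂ) * ψ (2 * n)))
        atTop (𝓝 0) ∧
      Tendsto (fun n : ℕ =>
          (q : ℂ) ^ (-(n : ℤ)) * ((q : ℂ) * ψ (2 * n - 1) - (t : ℂ) * ψ (2 * n)))
        atTop (𝓝 0) := Iff.rfl

lemma boundaryCond_infty_eigenSeq {q : ℝ} (hq : 0 < q) (hq1 : q < 1) {x : ℂ} (hx : x ≠ 0) :
    boundaryCond q OnePoint.infty (eigenSeq q x) ↔ qTheta ((q : ℂ) ^ 4) (x ^ 2) = 0 := by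
  have hq' : (q : ℂ) ≠ 0 := by exact_mod_cast hq.ne'
  have hq1' : ‖(q : ℂ)‖ < 1 := by rwa [Complex.norm_real, Real.norm_of_nonneg hq.le]
  rw [boundaryCond_infty_iff,
    tendsto_zero_iff_of_tendsto_signed (tendsto_eigenSeq_even hq' hq1' hx), mul_eq_zero,
    or_iff_right (boundaryConst_ne_zero hq1')]

lemma boundaryCond_coe_eigenSeq {q : ℝ} (hq : 0 < q) (hq1 : q < 1) (t : ℝ) {x : ℂ} (hx : x ≠ 0) :
    boundaryCond q (t : OnePoint ℝ) (eigenSeq q x) ↔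
      x * qTheta ((q : ℂ) ^ 4) ((q : ℂ) ^ 2 * x ^ 2)
          + (t : ℂ) * qTheta ((q : ℂ) ^ 4) (x ^ 2) = 0 := by
  have hq' : (q : ℂ) ≠ 0 := by exact_mod_cast hq.ne'
  have hq1' : ‖(q : ℂ)‖ < 1 := by rwa [Complex.norm_real, Real.norm_of_nonneg hq.le]
  have he := tendsto_eigenSeq_even hq' hq1' hx
  have ho := tendsto_eigenSeq_odd hq' hq1' hx
  set a := qTheta ((q : ℂ) ^ 4) (x ^ 2)
  set b := x * qTheta ((q : ℂ) ^ 4) ((q : ℂ) ^ 2 * x ^ 2)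
  set c := boundaryConst q
  have hc : c ≠ 0 := boundaryConst_ne_zero hq1'
  have h1 : Tendsto (fun n : ℕ => (-1) ^ n * ((q : ℂ) ^ (-(n : ℤ)) *
      (eigenSeq q x (2 * n + 1) + (t : ℂ) * eigenSeq q x (2 * n)))) atTop
      (𝓝 (c * b + t * (c * a))) := by
    refine (ho.add (he.const_mul (t : ℂ))).congr fun n => ?_
    ring
  have h2 : Tendsto (fun n : ℕ => (-1) ^ n * ((q : ℂ) ^ (-(n : ℤ)) *
      ((q : ℂ) * eigenSeq q x (2 * n - 1) - (t : ℂ) * eigenSeq q x (2 * n)))) atTop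
      (𝓝 (-(c * b) - t * (c * a))) := by
    -- Passing from `2n + 1` to `2n - 1` flips the sign `(-1)^n`, and the extra `q` compensates the
    -- change in `q^(-n)`. Both boundary limits therefore encode the same equation.
    have ho' : Tendsto (fun n : ℕ => (-1) ^ n * ((q : ℂ) ^ (-(n : ℤ)) *
        ((q : ℂ) * eigenSeq q x (2 * n - 1)))) atTop (𝓝 (-(c * b))) := by
      refine (tendsto_add_atTop_iff_nat 1).1 (ho.neg.congr fun n => ?_)
      rw [show (2 * ((n + 1 : ℕ) : ℤ) - 1) = 2 * n + 1 by push_cast; ring,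
        show (-((n + 1 : ℕ) : ℤ)) = -(n : ℤ) - 1 by push_cast; ring, zpow_sub_one₀ hq', pow_succ]
      field_simp
    refine (ho'.sub (he.const_mul (t : ℂ))).congr fun n => ?_
    ring
  rw [boundaryCond_coe_iff, tendsto_zero_iff_of_tendsto_signed h1,
    tendsto_zero_iff_of_tendsto_signed h2]
  have e1 : c * b + t * (c * a) = c * (b + t * a) := by ring
  have e2 : -(c * b) - t * (c * a) = c * -(b + t * a) := by ring
  rw [e1, e2, mul_eq_zero, mul_eq_zero, or_iff_right hc, or_iff_right hc, neg_eq_zero, and_self]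

lemma boundaryCond_smul {q : ℝ} {t : OnePoint ℝ} {ψ : ℤ → ℂ} (c : ℂ) (h : boundaryCond q t ψ) :
    boundaryCond q t (c • ψ) := by
  cases t using OnePoint.rec with
  | infty =>
    rw [boundaryCond_infty_iff] at h ⊢
    have h' := h.const_mul c
    rw [mul_zero] at h'
    refine h'.congr fun n => ?_
    simp only [Pi.smul_apply, smul_eq_mul]
    ring
  | coe t =>
    rw [boundaryCond_coe_iff] at h ⊢
    have h1 := h.1.const_mul c
    have h2 := h.2.const_mul c
    rw [mul_zero] at h1 h2
    refine ⟨h1.congr fun n => ?_, h2.congr fun n => ?_⟩ <;>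
    · simp only [Pi.smul_apply, smul_eq_mul]
      ring

/-- Splitting `q^(-2n)` evenly writes the scaled Wronskian with the conjugate, up to sign, as `f ḡ -
f̄ g`, with `f` the null boundary combination and `g` bounded. For finite `t` the extra terms cancel
because `t` is real. -/
lemma im_eq_zero_of_boundaryCond {q : ℝ} (hq : 0 < q) (hq1 : q < 1) {t : OnePoint ℝ} {x : ℂ}
    (hx : x ≠ 0) (h : boundaryCond q t (eigenSeq q x)) : x.im = 0 := by
  have hq' : (q : ℂ) ≠ 0 := by exact_mod_cast hq.ne'
  have hq1' : ‖(q : ℂ)‖ < 1 := by rwa [Complex.norm_real, Real.norm_of_nonneg hq.le]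
  refine im_eq_zero_of_tendsto_wronskian hq hq1 (eigenSeq_recurrence hq' hq1' hx)
    (memℓp_eigenSeq hq' hq1' hx) (eigenSeq_ne_zero hq' hq1' hx) ?_
  have hsq : ∀ n : ℕ, (q : ℂ) ^ (-(2 * n : ℤ)) = (q : ℂ) ^ (-(n : ℤ)) * (q : ℂ) ^ (-(n : ℤ)) := by
    intro n
    rw [← zpow_add₀ hq']
    congr 1
    ring
  have hconj : ∀ n : ℕ, (starRingEnd ℂ) ((q : ℂ) ^ (-(n : ℤ))) = (q : ℂ) ^ (-(n : ℤ)) := by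
    intro n
    rw [map_zpow₀, Complex.conj_ofReal]
  have bdd : ∀ {f : ℕ → ℂ} {L : ℂ}, Tendsto (fun n : ℕ => (-1) ^ n * f n) atTop (𝓝 L) →
      IsBoundedUnder (· ≤ ·) atTop (norm ∘ f) := by
    intro f L hf
    have := hf.norm.isBoundedUnder_le
    simpa [Function.comp_def] using this
  have negl : ∀ {f g : ℕ → ℂ}, Tendsto f atTop (𝓝 0) → IsBoundedUnder (· ≤ ·) atTop (norm ∘ g) →
      Tendsto (fun n => f n * (starRingEnd ℂ) (g n) - (starRingEnd ℂ) (f n) * g n) atTop (𝓝 0) := by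
    intro f g hf hg
    have h2 : Tendsto (fun n => f n * (starRingEnd ℂ) (g n)) atTop (𝓝 0) :=
      hf.zero_mul_isBoundedUnder_le (by simpa [Function.comp_def] using hg)
    have h3 : Tendsto (fun n => (starRingEnd ℂ) (f n) * g n) atTop (𝓝 0) := by
      have := (Complex.continuous_conj.tendsto _).comp h2
      simpa [Function.comp_def] using this
    simpa using h2.sub h3
  cases t using OnePoint.rec with
  | infty =>
    rw [boundaryCond_infty_iff] at h
    have h1 := (negl h (bdd (tendsto_eigenSeq_odd hq' hq1' hx))).neg
    rw [neg_zero] at h1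
    refine h1.congr fun n => ?_
    rw [wronskian, hsq, map_mul, map_mul, hconj]
    ring
  | coe t =>
    rw [boundaryCond_coe_iff] at h
    refine (negl h.1 (bdd (tendsto_eigenSeq_even hq' hq1' hx))).congr fun n => ?_
    rw [wronskian, hsq, map_mul, map_mul, map_add, map_mul, hconj, Complex.conj_ofReal]
    ring

/-! ### Eigenvectors and point spectrum of the extensions -/

lemma mem_jacobiExt_domain {q : ℝ} {t : OnePoint ℝ} {ψ : ℓ²(ℤ, ℂ)} :
    ψ ∈ (jacobiExt q t).domain ↔ boundaryCond q t ψ ∧ Memℓp (jacobiExpr q ψ) 2 := Iff.rfl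

lemma mem_pmapEigenspace_jacobiExt {q : ℝ} {t : OnePoint ℝ} {x : ℂ}
    {ψ : (jacobiExt q t).domain} : ψ ∈ pmapEigenspace (jacobiExt q t) x ↔
      jacobiExpr q (ψ : ℓ²(ℤ, ℂ)) = x • ((ψ : ℓ²(ℤ, ℂ)) : ℤ → ℂ) := by
  rw [pmapEigenspace, LinearMap.mem_ker, LinearMap.sub_apply, sub_eq_zero]
  exact Subtype.ext_iff

/-- An eigenvector of `A_t` is a multiple of `eigenSeq`, which then satisfies the boundary
condition. -/
lemma eigenvector_eq_smul_eigenSeq {q : ℝ} (hq : 0 < q) (hq1 : q < 1) {t : OnePoint ℝ} {x : ℂ}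
    (hx : x ≠ 0) {ψ : (jacobiExt q t).domain} (hψ : ψ ∈ pmapEigenspace (jacobiExt q t) x) :
    ∃ c : ℂ, ((ψ : ℓ²(ℤ, ℂ)) : ℤ → ℂ) = c • eigenSeq q x := by
  have hq' : (q : ℂ) ≠ 0 := by exact_mod_cast hq.ne'
  have hq1' : ‖(q : ℂ)‖ < 1 := by rwa [Complex.norm_real, Real.norm_of_nonneg hq.le]
  exact exists_eq_smul_of_recurrence hq' hq1' (eigenSeq_recurrence hq' hq1' hx)
    ((jacobiExpr_eq_smul_iff hq).1 (mem_pmapEigenspace_jacobiExt.1 hψ))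
    (memℓp_eigenSeq hq' hq1' hx) (lp.memℓp _) (eigenSeq_ne_zero hq' hq1' hx)

lemma coe_domain_ne_zero {q : ℝ} {t : OnePoint ℝ} {ψ : (jacobiExt q t).domain} (h : ψ ≠ 0) :
    ((ψ : ℓ²(ℤ, ℂ)) : ℤ → ℂ) ≠ 0 := by
  intro h0
  exact h (Subtype.ext (Subtype.ext h0))

lemma exists_eigenvector {q : ℝ} (hq : 0 < q) (hq1 : q < 1) {t : OnePoint ℝ} {x : ℂ}
    (hx : x ≠ 0) (h : boundaryCond q t (eigenSeq q x)) :
    ∃ v : pmapEigenspace (jacobiExt q t) x,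
      (((v : (jacobiExt q t).domain) : ℓ²(ℤ, ℂ)) : ℤ → ℂ) = eigenSeq q x ∧ v ≠ 0 := by
  have hq' : (q : ℂ) ≠ 0 := by exact_mod_cast hq.ne'
  have hq1' : ‖(q : ℂ)‖ < 1 := by rwa [Complex.norm_real, Real.norm_of_nonneg hq.le]
  have hmem := memℓp_eigenSeq hq' hq1' hx
  have hrec := (jacobiExpr_eq_smul_iff hq).2 (eigenSeq_recurrence hq' hq1' hx)
  have hmem' : Memℓp (jacobiExpr q (eigenSeq q x)) 2 := by
    rw [hrec]
    exact hmem.const_smul x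
  let ψ : (jacobiExt q t).domain := ⟨⟨eigenSeq q x, hmem⟩, h, hmem'⟩
  refine ⟨⟨ψ, mem_pmapEigenspace_jacobiExt.2 hrec⟩, rfl, fun h0 => ?_⟩
  have h1 : ψ = 0 := congrArg Subtype.val h0
  exact eigenSeq_ne_zero hq' hq1' hx (congrArg (fun φ : (jacobiExt q t).domain =>
    ((φ : ℓ²(ℤ, ℂ)) : ℤ → ℂ)) h1)

lemma mem_pointSpectrum_jacobiExt_iff {q : ℝ} (hq : 0 < q) (hq1 : q < 1) {t : OnePoint ℝ} {x : ℂ} :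
    x ∈ pointSpectrum (jacobiExt q t) ↔ x ≠ 0 ∧ boundaryCond q t (eigenSeq q x) := by
  have hq1' : ‖(q : ℂ)‖ < 1 := by rwa [Complex.norm_real, Real.norm_of_nonneg hq.le]
  constructor
  · intro h
    obtain ⟨ψ, hψ, hψ0⟩ := (Submodule.ne_bot_iff _).1 h
    have hx : x ≠ 0 := by
      rintro rfl
      exact coe_domain_ne_zero hψ0 (eq_zero_of_recurrence_zero hq1'
        ((jacobiExpr_eq_smul_iff hq).1 (mem_pmapEigenspace_jacobiExt.1 hψ)) (lp.memℓp _))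
    obtain ⟨c, hc⟩ := eigenvector_eq_smul_eigenSeq hq hq1 hx hψ
    have hc0 : c ≠ 0 := by
      rintro rfl
      exact coe_domain_ne_zero hψ0 (by rw [hc, zero_smul])
    have hb := boundaryCond_smul c⁻¹ (mem_jacobiExt_domain.1 ψ.2).1
    rw [hc, inv_smul_smul₀ hc0] at hb
    exact ⟨hx, hb⟩
  · rintro ⟨hx, h⟩
    obtain ⟨v, -, hv⟩ := exists_eigenvector hq hq1 hx h
    exact (Submodule.ne_bot_iff _).2 ⟨v, v.2, fun h0 => hv (Subtype.ext h0)⟩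

theorem mainTheorem2 (q : ℝ) (hq0 : 0 < q) (hq1 : q < 1) :
    (∀ t : ℝ, pointSpectrum (jacobiExt q (t : OnePoint ℝ)) =
      {x : ℂ | x ≠ 0 ∧
        x * qTheta ((q : ℂ) ^ 4) ((q : ℂ) ^ 2 * x ^ 2)
          + (t : ℂ) * qTheta ((q : ℂ) ^ 4) (x ^ 2) = 0}) ∧
    (pointSpectrum (jacobiExt q (OnePoint.infty : OnePoint ℝ)) =
      {x : ℂ | x ≠ 0 ∧ qTheta ((q : ℂ) ^ 4) (x ^ 2) = 0}) ∧
    (∀ t : OnePoint ℝ, ∀ x ∈ pointSpectrum (jacobiExt q t),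
      x.im = 0 ∧ Module.finrank ℂ (pmapEigenspace (jacobiExt q t) x) = 1) := by
  refine ⟨fun t => ?_, ?_, fun t x hx => ?_⟩
  · ext x
    rw [mem_pointSpectrum_jacobiExt_iff hq0 hq1]
    exact and_congr_right fun hx => boundaryCond_coe_eigenSeq hq0 hq1 t hx
  · ext x
    rw [mem_pointSpectrum_jacobiExt_iff hq0 hq1]
    exact and_congr_right fun hx => boundaryCond_infty_eigenSeq hq0 hq1 hx
  · obtain ⟨hx0, hb⟩ := (mem_pointSpectrum_jacobiExt_iff hq0 hq1).1 hx
    refine ⟨im_eq_zero_of_boundaryCond hq0 hq1 hx0 hb, ?_⟩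
    obtain ⟨v, hv, hv0⟩ := exists_eigenvector hq0 hq1 hx0 hb
    refine (finrank_eq_one_iff_of_nonzero' v hv0).2 fun w => ?_
    obtain ⟨c, hc⟩ := eigenvector_eq_smul_eigenSeq hq0 hq1 hx0 w.2
    refine ⟨c, Subtype.ext (Subtype.ext (Subtype.ext ?_))⟩
    rw [hc, ← hv]
    rfl
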